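/- Let $K$ be the ring of formal power series of bounded degree with integer coefficients in the countably infinitely many variables $x_1,x_2,\ldots$ (that is, formal power series $f$ for which there is a $d$ such that every monomial of total degree greater than $d$ has coefficient $0$ in $f$). A symmetric function is an element of $K$ that is invariant under every permutation of the variables. Let $h$ be a nonzero symmetric function, and suppose that $h=f\cdot g$ with $f,g\in K$ arbitrary. Then $f$ and $g$ are both symmetric functions. -/

import Mathlib

/-- The ring `K` of formal power series of bounded degree over `ℤ` in countably many variables
`x_i`, `i : ℕ`: all monomials of sufficiently large total degree have coefficient zero. -/
def boundedDegreeSeries : Subring (MvPowerSeries ℕ ℤ) where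
  carrier := {f | ∃ d : ℕ, ∀ m : ℕ →₀ ℕ, d < m.degree → MvPowerSeries.coeff m f = 0}
  zero_mem' := ⟨0, fun m _ => by simp⟩
  one_mem' := ⟨0, fun m hm => by
    classical
    rw [MvPowerSeries.coeff_one, if_neg]
    rintro rfl
    simp at hm⟩
  add_mem' := by
    rintro f g ⟨a, ha⟩ ⟨b, hb⟩
    refine ⟨max a b, fun m hm => ?_⟩
    rw [map_add, ha m (lt_of_le_of_lt (le_max_left a b) hm),
      hb m (lt_of_le_of_lt (le_max_right a b) hm), add_zero]
  neg_mem' := by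
    rintro f ⟨a, ha⟩
    exact ⟨a, fun m hm => by rw [map_neg, ha m hm, neg_zero]⟩
  mul_mem' := by
    classical
    rintro f g ⟨a, ha⟩ ⟨b, hb⟩
    refine ⟨a + b, fun m hm => ?_⟩
    rw [MvPowerSeries.coeff_mul]
    refine Finset.sum_eq_zero fun p hp => ?_
    rw [Finset.HasAntidiagonal.mem_antidiagonal] at hp
    have hdeg : p.1.degree + p.2.degree = m.degree := by rw [← hp, map_add]
    by_cases h1 : a < p.1.degree
    · rw [ha _ h1, zero_mul]
    · rw [hb _ (by omega), mul_zero]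

/-- The ring `Sym` of symmetric functions over `ℤ` in countably many variables: the power series
of bounded degree that are unchanged by every permutation of the variables. -/
def symmetricFunctions : Subring (MvPowerSeries ℕ ℤ) where
  carrier := {f | f ∈ boundedDegreeSeries ∧
    ∀ π : Equiv.Perm ℕ, MvPowerSeries.rename π f = f}
  zero_mem' := ⟨zero_mem _, fun _ => map_zero _⟩
  one_mem' := ⟨one_mem _, fun _ => map_one _⟩
  add_mem' := fun ha hb => ⟨add_mem ha.1 hb.1, fun π => by rw [map_add, ha.2, hb.2]⟩
  neg_mem' := fun ha => ⟨neg_mem ha.1, fun π => by rw [map_neg, ha.2]⟩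
  mul_mem' := fun ha hb => ⟨mul_mem ha.1 hb.1, fun π => by rw [map_mul, ha.2, hb.2]⟩

/-!
A factor of a symmetric function is symmetric because it has only finitely many images under
permutations of the variables, while `Equiv.Perm ℕ` is too large to act nontrivially on a finite
set.

Finiteness of the orbit: if `h = f * g` is symmetric then every image of `f` divides `h`, with the
same degree bounds. Setting all but finitely many variables to zero (`restrictVars`) turns these
factors into divisors of a polynomial over `ℤ`, which is a unique factorization domain. A polynomial
of degree at most `d` with a nonzero coefficient `c` has at most `d + |c|` prime factors, hence at
most `2 ^ (d + |c|) * 2` divisors (`MvPolynomial.card_le_of_forall_dvd`). The bound does not depend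
on the number of variables that are kept, so it holds for the factors of `h` themselves
(`finite_setOf_mul_eq`).

Finite orbit implies symmetric: among infinitely many disjoint transpositions two act in the same
way on the orbit. Their product acts trivially on it, and so do all its conjugates, that is, all
products `(a b)(c d)` of disjoint transpositions. Given a monomial, `c` and `d` may be chosen outside
it, so the transposition `(a b)` alone preserves every coefficient. Finally, a permutation acts on a
given monomial like a product of transpositions (`rename_eq_of_finite_orbit`).
-/

/-! ### Permutations of the variables and bounds on the degree -/

open MvPowerSeries in
theorem coeff_mapDomain_rename_perm (π : Equiv.Perm ℕ) (f : MvPowerSeries ℕ ℤ) (m : ℕ →₀ ℕ) :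
    coeff (m.mapDomain π) (rename π f) = coeff m f := by
  have := coeff_embDomain_rename π.toEmbedding f m
  rwa [Finsupp.embDomain_eq_mapDomain] at this

theorem rename_perm_mul (π ρ : Equiv.Perm ℕ) (f : MvPowerSeries ℕ ℤ) :
    MvPowerSeries.rename (π * ρ : Equiv.Perm ℕ) f =
      MvPowerSeries.rename π (MvPowerSeries.rename ρ f) := by
  rw [MvPowerSeries.rename_rename]
  rfl

theorem rename_perm_one (f : MvPowerSeries ℕ ℤ) :
    MvPowerSeries.rename (1 : Equiv.Perm ℕ) f = f :=
  MvPowerSeries.rename_id_apply f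

/-- The condition on `f` that all monomials of total degree above `d` have coefficient zero. -/
def DegreeAtMost (d : ℕ) (f : MvPowerSeries ℕ ℤ) : Prop :=
  ∀ m : ℕ →₀ ℕ, d < m.degree → MvPowerSeries.coeff m f = 0

theorem DegreeAtMost.mono {d e : ℕ} (hde : d ≤ e) {f : MvPowerSeries ℕ ℤ}
    (hf : DegreeAtMost d f) : DegreeAtMost e f :=
  fun m hm => hf m (hde.trans_lt hm)

theorem DegreeAtMost.rename {d : ℕ} {f : MvPowerSeries ℕ ℤ} (hf : DegreeAtMost d f)
    (π : Equiv.Perm ℕ) : DegreeAtMost d (MvPowerSeries.rename π f) := by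
  intro m hm
  have hm' : (m.mapDomain (π⁻¹ : Equiv.Perm ℕ)).mapDomain π = m := by
    rw [← Finsupp.mapDomain_comp]
    convert Finsupp.mapDomain_id
    ext a; simp
  rw [← hm', coeff_mapDomain_rename_perm]
  apply hf
  rwa [Finsupp.degree_mapDomain]

/-! ### Counting divisors of an integer polynomial -/

namespace MvPolynomial

variable {σ : Type*}

/-- A product of nonzero nonunits splits into its constant and its nonconstant factors. Every
constant factor has absolute value at least `2` and every other factor has degree at least `1`, so
the two products together bound the number of factors. -/
theorem exists_C_mul_eq_multiset_prod (s : Multiset (MvPolynomial σ ℤ))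
    (h0 : ∀ p ∈ s, p ≠ 0) (hs : ∀ p ∈ s, ¬ IsUnit p) :
    ∃ (e : ℤ) (q : MvPolynomial σ ℤ), e ≠ 0 ∧ q ≠ 0 ∧ s.prod = C e * q ∧
      s.card ≤ q.totalDegree + e.natAbs := by
  induction s using Multiset.induction_on with
  | empty => exact ⟨1, 1, one_ne_zero, one_ne_zero, by simp, by simp⟩
  | cons p s ih =>
    obtain ⟨e, q, he, hq, hprod, hcard⟩ := ih (fun p hp => h0 p (Multiset.mem_cons_of_mem hp))
      (fun p hp => hs p (Multiset.mem_cons_of_mem hp))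
    have hp0 := h0 p (Multiset.mem_cons_self p s)
    have hpu := hs p (Multiset.mem_cons_self p s)
    by_cases hdeg : p.totalDegree = 0
    · obtain ⟨a, rfl⟩ : ∃ a, p = C a := ⟨_, totalDegree_eq_zero_iff_eq_C.1 hdeg⟩
      have ha0 : a ≠ 0 := by rintro rfl; simp at hp0
      have ha1 : a.natAbs ≠ 1 := fun h => hpu ((Int.isUnit_iff_natAbs_eq.2 h).map C)
      have ha : 2 ≤ a.natAbs := by omega
      refine ⟨a * e, q, mul_ne_zero ha0 he, hq, by simp [hprod, mul_assoc], ?_⟩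
      have : 1 ≤ e.natAbs := by omega
      rw [Multiset.card_cons, Int.natAbs_mul]
      nlinarith
    · refine ⟨e, p * q, he, mul_ne_zero hp0 hq, by rw [Multiset.prod_cons, hprod]; ring, ?_⟩
      rw [Multiset.card_cons, totalDegree_mul_of_isDomain hp0 hq]
      omega

/-- A bound for the number of divisors that depends only on the degree and on one nonzero
coefficient, not on the number of variables. -/
theorem card_le_of_forall_dvd {P : MvPolynomial σ ℤ} {m : σ →₀ ℕ} (hm : P.coeff m ≠ 0)
    (T : Finset (MvPolynomial σ ℤ)) (hT : ∀ u ∈ T, u ∣ P) :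
    T.card ≤ 2 ^ (P.totalDegree + (P.coeff m).natAbs) * 2 := by
  classical
  let : StrongNormalizationMonoid (MvPolynomial σ ℤ) :=
    UniqueFactorizationMonoid.strongNormalizationMonoid
  have hP : P ≠ 0 := by rintro rfl; simp at hm
  set s := UniqueFactorizationMonoid.normalizedFactors P
  have hcard : s.card ≤ P.totalDegree + (P.coeff m).natAbs := by
    obtain ⟨e, q, -, -, hprod, hle⟩ := exists_C_mul_eq_multiset_prod s
      (fun p hp => UniqueFactorizationMonoid.ne_zero_of_mem_normalizedFactors hp)
      (fun p hp => (UniqueFactorizationMonoid.prime_of_normalized_factor p hp).not_isUnit)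
    have hdvd : C e * q ∣ P :=
      hprod ▸ (UniqueFactorizationMonoid.prod_normalizedFactors hP).dvd
    have hq : q.totalDegree ≤ P.totalDegree :=
      totalDegree_le_of_dvd_of_isDomain ((Dvd.intro_left _ rfl).trans hdvd) hP
    have he : e ∣ P.coeff m := (C_dvd_iff_dvd_coeff e P).1 ((Dvd.intro _ rfl).trans hdvd) m
    have := Nat.le_of_dvd (Int.natAbs_pos.2 hm) (Int.natAbs_dvd_natAbs.2 he)
    omega
  have hsub : T ⊆ (s.powerset.toFinset ×ˢ ({1, -1} : Finset ℤ)).image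
      fun x => x.1.prod * C x.2 := by
    intro u hu
    have hu0 : u ≠ 0 := ne_zero_of_dvd_ne_zero hP (hT u hu)
    obtain ⟨w, hw⟩ := UniqueFactorizationMonoid.prod_normalizedFactors hu0
    obtain ⟨r, hr, hwr⟩ := isUnit_iff_eq_C_of_isReduced.1 w.isUnit
    refine Finset.mem_image.2 ⟨(UniqueFactorizationMonoid.normalizedFactors u, r), ?_, ?_⟩
    · simp only [Finset.mem_product, Multiset.mem_toFinset, Multiset.mem_powerset,
        Finset.mem_insert, Finset.mem_singleton]
      exact ⟨(UniqueFactorizationMonoid.dvd_iff_normalizedFactors_le_normalizedFactors hu0 hP).1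
        (hT u hu), Int.isUnit_iff.1 hr⟩
    · simpa only [hwr] using hw
  calc T.card ≤ (s.powerset.toFinset ×ˢ ({1, -1} : Finset ℤ)).card :=
        (Finset.card_le_card hsub).trans Finset.card_image_le
    _ ≤ 2 ^ s.card * 2 := by
        rw [Finset.card_product, ← Multiset.card_powerset s]
        exact Nat.mul_le_mul (Multiset.toFinset_card_le _) Finset.card_le_two
    _ ≤ _ := by gcongr; norm_num

end MvPolynomial

/-! ### Restriction to finitely many variables -/

/-- The exponent vector that is `d` on `A` and `0` elsewhere. -/
noncomputable def boxExponent (d : ℕ) (A : Finset ℕ) : ℕ →₀ ℕ :=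
  Finsupp.indicator A fun _ _ => d

theorem le_boxExponent {d : ℕ} {A : Finset ℕ} {m : ℕ →₀ ℕ} (hA : m.support ⊆ A)
    (hd : m.degree ≤ d) : m ≤ boxExponent d A := by
  intro i
  by_cases hi : i ∈ A
  · rw [boxExponent, Finsupp.indicator_of_mem hi]
    exact (Finsupp.le_degree i m).trans hd
  · rw [Finsupp.notMem_support_iff.1 fun h => hi (hA h)]
    exact Nat.zero_le _

theorem support_subset_of_le_boxExponent {d : ℕ} {A : Finset ℕ} {m : ℕ →₀ ℕ}
    (h : m ≤ boxExponent d A) : m.support ⊆ A := by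
  intro i hi
  by_contra hiA
  have := h i
  rw [boxExponent, Finsupp.indicator_of_notMem hiA] at this
  exact Finsupp.mem_support_iff.1 hi (Nat.le_zero.1 this)

/-- Setting the variables outside the finite set `A` to zero, for series of degree at most `d`:
such a series then becomes a polynomial, whose exponents are all bounded by `boxExponent d A`. -/
noncomputable def restrictVars (d : ℕ) (A : Finset ℕ) (f : MvPowerSeries ℕ ℤ) :
    MvPolynomial ℕ ℤ :=
  MvPowerSeries.trunc' ℤ (boxExponent d A) f

theorem DegreeAtMost.coeff_restrictVars {d : ℕ} {f : MvPowerSeries ℕ ℤ} (hf : DegreeAtMost d f)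
    (A : Finset ℕ) (m : ℕ →₀ ℕ) [Decidable (m.support ⊆ A)] :
    (restrictVars d A f).coeff m = if m.support ⊆ A then MvPowerSeries.coeff m f else 0 := by
  classical
  rw [restrictVars, MvPowerSeries.coeff_trunc']
  by_cases hA : m.support ⊆ A
  · by_cases hd : m.degree ≤ d
    · rw [if_pos (le_boxExponent hA hd), if_pos hA]
    · rw [hf m (not_le.1 hd), ite_self, ite_self]
  · rw [if_neg hA, if_neg fun h => hA (support_subset_of_le_boxExponent h)]

theorem restrictVars_mul {d : ℕ} {f g : MvPowerSeries ℕ ℤ} (hf : DegreeAtMost d f)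
    (hg : DegreeAtMost d g) (hfg : DegreeAtMost d (f * g)) (A : Finset ℕ) :
    restrictVars d A (f * g) = restrictVars d A f * restrictVars d A g := by
  classical
  ext m
  rw [hfg.coeff_restrictVars, MvPolynomial.coeff_mul, MvPowerSeries.coeff_mul]
  have key : ∀ x ∈ Finset.HasAntidiagonal.antidiagonal m,
      (m.support ⊆ A ↔ x.1.support ⊆ A ∧ x.2.support ⊆ A) := by
    intro x hx
    rw [← Finset.HasAntidiagonal.mem_antidiagonal.1 hx, ← Finset.union_subset_iff]
    suffices (x.1 + x.2).support = x.1.support ∪ x.2.support by rw [this]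
    ext i
    simp only [Finsupp.mem_support_iff, Finsupp.add_apply, Finset.mem_union]
    omega
  split_ifs with hA
  · refine Finset.sum_congr rfl fun x hx => ?_
    obtain ⟨h1, h2⟩ := (key x hx).1 hA
    rw [hf.coeff_restrictVars, hg.coeff_restrictVars, if_pos h1, if_pos h2]
  · refine (Finset.sum_eq_zero fun x hx => ?_).symm
    rw [hf.coeff_restrictVars, hg.coeff_restrictVars]
    by_cases h1 : x.1.support ⊆ A
    · rw [if_neg fun h2 => hA ((key x hx).2 ⟨h1, h2⟩), mul_zero]
    · rw [if_neg h1, zero_mul]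

theorem totalDegree_restrictVars_le {d : ℕ} {f : MvPowerSeries ℕ ℤ} (hf : DegreeAtMost d f)
    (A : Finset ℕ) : (restrictVars d A f).totalDegree ≤ d := by
  classical
  refine Finset.sup_le fun m hm => ?_
  by_contra hd
  refine MvPolynomial.mem_support_iff.1 hm ?_
  rw [hf.coeff_restrictVars, hf m, ite_self]
  exact not_le.1 hd

/-- Finitely many series of bounded degree can be told apart by restricting to finitely many
variables. -/
theorem exists_injOn_restrictVars {d : ℕ} (S : Finset (MvPowerSeries ℕ ℤ))
    (hS : ∀ u ∈ S, DegreeAtMost d u) (B : Finset ℕ) :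
    ∃ A : Finset ℕ, B ⊆ A ∧ Set.InjOn (restrictVars d A) S := by
  classical
  have hex : ∀ u v : MvPowerSeries ℕ ℤ, ∃ m : ℕ →₀ ℕ,
      u ≠ v → MvPowerSeries.coeff m u ≠ MvPowerSeries.coeff m v := by
    intro u v
    by_cases huv : u = v
    · exact ⟨0, fun h => (h huv).elim⟩
    · by_contra! hne
      exact huv (MvPowerSeries.ext fun m => (hne m).2)
  choose m hm using hex
  refine ⟨B ∪ (S ×ˢ S).biUnion fun x => (m x.1 x.2).support, Finset.subset_union_left, ?_⟩
  intro u hu v hv huv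
  by_contra hne
  have hsub : (m u v).support ⊆ B ∪ (S ×ˢ S).biUnion fun x => (m x.1 x.2).support :=
    (Finset.subset_biUnion_of_mem (fun x => (m x.1 x.2).support)
      (Finset.mem_product.2 ⟨hu, hv⟩ : (u, v) ∈ S ×ˢ S)).trans Finset.subset_union_right
  have := congrArg (MvPolynomial.coeff (m u v)) huv
  rw [(hS u hu).coeff_restrictVars, (hS v hv).coeff_restrictVars, if_pos hsub, if_pos hsub] at this
  exact hm u v hne this

/-- A nonzero series has only finitely many factors of bounded degree with a cofactor of bounded
degree: restricted to finitely many variables, these become divisors of one polynomial, and their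
number is bounded independently of the number of variables. -/
theorem finite_setOf_mul_eq {d : ℕ} {h : MvPowerSeries ℕ ℤ} (hd : DegreeAtMost d h) (h_ne : h ≠ 0) :
    {u | DegreeAtMost d u ∧ ∃ v, DegreeAtMost d v ∧ u * v = h}.Finite := by
  classical
  obtain ⟨m, hm⟩ : ∃ m, MvPowerSeries.coeff m h ≠ 0 := by
    by_contra! h0
    exact h_ne (MvPowerSeries.ext fun m => by simp [h0 m])
  by_contra hinf
  obtain ⟨S, hS, hcard⟩ := Set.Infinite.exists_subset_card_eq hinf
    (2 ^ (d + (MvPowerSeries.coeff m h).natAbs) * 2 + 1)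
  obtain ⟨A, hmA, hinj⟩ := exists_injOn_restrictVars S (fun u hu => (hS hu).1) m.support
  have hcoeff : (restrictVars d A h).coeff m = MvPowerSeries.coeff m h := by
    rw [hd.coeff_restrictVars, if_pos hmA]
  have hle := MvPolynomial.card_le_of_forall_dvd (hcoeff ▸ hm) (S.image (restrictVars d A)) (by
    intro p hp
    obtain ⟨u, hu, rfl⟩ := Finset.mem_image.1 hp
    obtain ⟨hud, v, hvd, rfl⟩ := hS hu
    exact ⟨_, restrictVars_mul hud hvd hd A⟩)
  rw [Finset.card_image_of_injOn hinj, hcard, hcoeff] at hle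
  have : 2 ^ ((restrictVars d A h).totalDegree + (MvPowerSeries.coeff m h).natAbs) ≤
      2 ^ (d + (MvPowerSeries.coeff m h).natAbs) :=
    Nat.pow_le_pow_right two_pos (Nat.add_le_add_right (totalDegree_restrictVars_le hd A) _)
  omega

/-! ### Series with a finite orbit -/

/-- The product of two disjoint transpositions fixes every series with finite orbit. -/
theorem rename_swap_mul_swap_of_finite_orbit {f : MvPowerSeries ℕ ℤ}
    (hf : (Set.range fun π : Equiv.Perm ℕ => MvPowerSeries.rename π f).Finite)
    {a b c d : ℕ} (habcd : [a, b, c, d].Nodup) :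
    MvPowerSeries.rename (Equiv.swap a b * Equiv.swap c d : Equiv.Perm ℕ) f = f := by
  have := hf.to_subtype
  let O := Set.range fun π : Equiv.Perm ℕ => MvPowerSeries.rename π f
  -- Infinitely many disjoint transpositions act on a finite orbit, so two of them act alike.
  let act : ℕ → O → O := fun r u =>
    ⟨MvPowerSeries.rename (Equiv.swap (2 * r) (2 * r + 1)) u.1, by
      obtain ⟨-, π, rfl⟩ := u
      exact ⟨Equiv.swap (2 * r) (2 * r + 1) * π, rename_perm_mul _ _ _⟩⟩
  obtain ⟨r, s, hrs, hact⟩ := Finite.exists_ne_map_eq_of_infinite act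
  have hact' (π : Equiv.Perm ℕ) :
      MvPowerSeries.rename (Equiv.swap (2 * r) (2 * r + 1) * π : Equiv.Perm ℕ) f =
        MvPowerSeries.rename (Equiv.swap (2 * s) (2 * s + 1) * π : Equiv.Perm ℕ) f := by
    rw [rename_perm_mul, rename_perm_mul]
    exact congrArg Subtype.val (congrFun hact ⟨_, π, rfl⟩)
  -- Conjugation carries this pair of transpositions to the given pair.
  obtain ⟨π, hπ⟩ := Equiv.Perm.exists_extending_pair ![a, b, c, d]
    ![2 * r, 2 * r + 1, 2 * s, 2 * s + 1]
    (by
      simp only [List.nodup_cons, List.mem_cons, List.not_mem_nil, or_false, not_or] at habcd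
      intro i j
      fin_cases i <;> fin_cases j <;> simp <;> omega)
    (by
      intro i j
      fin_cases i <;> fin_cases j <;> simp <;> omega)
  have h0 : π a = 2 * r := hπ 0
  have h1 : π b = 2 * r + 1 := hπ 1
  have h2 : π c = 2 * s := hπ 2
  have h3 : π d = 2 * s + 1 := hπ 3
  have hconj : Equiv.swap (2 * r) (2 * r + 1) * (π * Equiv.swap c d) =
      π * (Equiv.swap a b * Equiv.swap c d) := by
    rw [← mul_assoc, ← mul_assoc, Equiv.mul_swap_eq_swap_mul π a b, h0, h1]
  have hconj' : Equiv.swap (2 * s) (2 * s + 1) * (π * Equiv.swap c d) = π := by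
    rw [Equiv.mul_swap_eq_swap_mul π c d, h2, h3, Equiv.swap_mul_self_mul]
  have h := hact' (π * Equiv.swap c d)
  rw [hconj, hconj', rename_perm_mul] at h
  exact MvPowerSeries.rename_injective π.toEmbedding h

/-- A single transposition also fixes such a series: its effect on the coefficient of one monomial
does not change when it is multiplied by a transposition of variables outside that monomial. -/
theorem rename_swap_of_finite_orbit {f : MvPowerSeries ℕ ℤ}
    (hf : (Set.range fun π : Equiv.Perm ℕ => MvPowerSeries.rename π f).Finite)
    {a b : ℕ} (hab : a ≠ b) : MvPowerSeries.rename (Equiv.swap a b) f = f := by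
  classical
  ext m
  obtain ⟨c, hc⟩ := Infinite.exists_notMem_finset (m.support ∪ {a, b})
  obtain ⟨d, hd⟩ := Infinite.exists_notMem_finset (m.support ∪ {a, b, c})
  simp only [Finset.mem_union, Finset.mem_insert, Finset.mem_singleton, not_or] at hc hd
  have hfix := rename_swap_mul_swap_of_finite_orbit hf (a := a) (b := b) (c := c) (d := d)
    (by simp; omega)
  have hm : m.mapDomain (Equiv.swap c d) = m := by
    conv_rhs => rw [← Finsupp.mapDomain_id (v := m)]
    refine Finsupp.mapDomain_congr fun i hi => ?_
    exact Equiv.swap_apply_of_ne_of_ne (fun h => hc.1 (h ▸ hi)) (fun h => hd.1 (h ▸ hi))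
  have hcomm : Equiv.swap a b * Equiv.swap c d = Equiv.swap c d * Equiv.swap a b := by
    rw [Equiv.mul_swap_eq_swap_mul, Equiv.swap_apply_of_ne_of_ne hc.2.1 hc.2.2,
      Equiv.swap_apply_of_ne_of_ne hd.2.1 hd.2.2.1]
  calc MvPowerSeries.coeff m (MvPowerSeries.rename (Equiv.swap a b) f)
      = MvPowerSeries.coeff (m.mapDomain (Equiv.swap c d)) (MvPowerSeries.rename (Equiv.swap c d)
          (MvPowerSeries.rename (Equiv.swap a b) f)) :=
        (coeff_mapDomain_rename_perm _ _ _).symm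
    _ = MvPowerSeries.coeff m f := by rw [← rename_perm_mul, ← hcomm, hfix, hm]

/-- On a finite set every permutation agrees with a product of transpositions, so with a permutation
that fixes `f` if all transpositions do. -/
theorem exists_perm_eqOn_of_swap_invariant {f : MvPowerSeries ℕ ℤ}
    (hf : ∀ a b : ℕ, a ≠ b → MvPowerSeries.rename (Equiv.swap a b) f = f)
    (π : Equiv.Perm ℕ) (A : Finset ℕ) :
    ∃ ρ : Equiv.Perm ℕ, (∀ a ∈ A, π a = ρ a) ∧ MvPowerSeries.rename ρ f = f := by
  classical
  induction A using Finset.induction_on with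
  | empty => exact ⟨1, by simp, rename_perm_one f⟩
  | insert x A hx ih =>
    obtain ⟨ρ, hρ, hρf⟩ := ih
    by_cases hxx : π x = ρ x
    · exact ⟨ρ, Finset.forall_mem_insert _ _ _ |>.2 ⟨hxx, hρ⟩, hρf⟩
    · refine ⟨Equiv.swap (ρ x) (π x) * ρ, Finset.forall_mem_insert _ _ _ |>.2 ⟨?_, ?_⟩, ?_⟩
      · simp
      · intro a ha
        have hax : a ≠ x := fun h => hx (h ▸ ha)
        rw [Equiv.Perm.mul_apply, Equiv.swap_apply_of_ne_of_ne (ρ.injective.ne hax), hρ a ha]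
        rw [← hρ a ha]
        exact π.injective.ne hax
      · rw [rename_perm_mul, hρf, hf _ _ (Ne.symm hxx)]

/-- A series with only finitely many images under permutations of the variables is symmetric. -/
theorem rename_eq_of_finite_orbit {f : MvPowerSeries ℕ ℤ}
    (hf : (Set.range fun π : Equiv.Perm ℕ => MvPowerSeries.rename π f).Finite)
    (π : Equiv.Perm ℕ) : MvPowerSeries.rename π f = f := by
  suffices h : ∀ σ : Equiv.Perm ℕ, ∀ m : ℕ →₀ ℕ,
      MvPowerSeries.coeff (m.mapDomain σ) f = MvPowerSeries.coeff m f by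
    ext m
    rw [← h π⁻¹ m, ← coeff_mapDomain_rename_perm π⁻¹, ← rename_perm_mul, inv_mul_cancel,
      rename_perm_one]
  intro σ m
  obtain ⟨ρ, hρ, hρf⟩ := exists_perm_eqOn_of_swap_invariant
    (fun _ _ hab => rename_swap_of_finite_orbit hf hab) σ m.support
  rw [Finsupp.mapDomain_congr hρ]
  conv_lhs => rw [← hρf]
  exact coeff_mapDomain_rename_perm ρ f m

/-- A factor of bounded degree of a nonzero symmetric function, with a cofactor of bounded degree,
is symmetric: its images under permutations are again such factors, so there are finitely many. -/
theorem mem_symmetricFunctions_of_mul {f g h : MvPowerSeries ℕ ℤ}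
    (hf : f ∈ boundedDegreeSeries) (hg : g ∈ boundedDegreeSeries)
    (hh : h ∈ symmetricFunctions) (h_ne : h ≠ 0) (h_eq : h = f * g) :
    f ∈ symmetricFunctions := by
  refine ⟨hf, rename_eq_of_finite_orbit ?_⟩
  obtain ⟨a, ha : DegreeAtMost a f⟩ := hf
  obtain ⟨b, hb : DegreeAtMost b g⟩ := hg
  obtain ⟨⟨c, hc : DegreeAtMost c h⟩, hsymm⟩ := hh
  have hfd : DegreeAtMost (a + b + c) f := ha.mono (by omega)
  have hgd : DegreeAtMost (a + b + c) g := hb.mono (by omega)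
  refine (finite_setOf_mul_eq (hc.mono (by omega : c ≤ a + b + c)) h_ne).subset ?_
  rintro _ ⟨π, rfl⟩
  exact ⟨hfd.rename π, _, hgd.rename π, by rw [← map_mul, ← h_eq, hsymm]⟩

theorem mainTheorem9 (f g h : MvPowerSeries ℕ ℤ)
    (hf : f ∈ boundedDegreeSeries) (hg : g ∈ boundedDegreeSeries)
    (hh : h ∈ symmetricFunctions) (h_ne : h ≠ 0) (h_eq : h = f * g) :
    f ∈ symmetricFunctions ∧ g ∈ symmetricFunctions :=
  ⟨mem_symmetricFunctions_of_mul hf hg hh h_ne h_eq,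
    mem_symmetricFunctions_of_mul hg hf hh h_ne (h_eq.trans (mul_comm f g))⟩
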